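/- **Theorem (Optimal Embeddings for the Cyclic-Shift Group).** Let $m,d$ be positive integers with $d\ge m$ and let $E_W,E_H>0$. For $\boldsymbol z\in\mathbb R^m$ let $\sigma(\boldsymbol z)_i=\exp(z_i)/\sum_{k=1}^m\exp(z_k)$ be the softmax and let $\mathcal L(\boldsymbol q,\boldsymbol p)=-\sum_{i=1}^m p_i\log q_i$ be the cross-entropy loss. Let $\Pi$ be the $m\times m$ cyclic-shift matrix, $\Pi(y_1,\dots,y_m)^\top=(y_m,y_1,\dots,y_{m-1})^\top$. A real $m\times m$ matrix is called circulant if it is of the form $[\boldsymbol a,\Pi\boldsymbol a,\dots,\Pi^{m-1}\boldsymbol a]$ for some generating vector $\boldsymbol a\in\mathbb R^m$. Let $\boldsymbol y\in\mathbb R^m$ be a probability vector different from the uniform distribution $(1/m,\dots,1/m)^\top$, and let $Y=[\boldsymbol y,\Pi\boldsymbol y,\dots,\Pi^{m-1}\boldsymbol y]$. Consider the problem $$\min_{W\in\mathbb R^{m\times d},\,H\in\mathbb R^{d\times m}}\ \sum_{j=1}^m\mathcal L\big(\sigma((WH)_{:,j}),Y_{:,j}\big)\quad\text{s.t.}\quad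 \|W\|_F^2\le E_W,\ \|H\|_F^2\le E_H,\tag{1}$$ and assume that its constraints are active at the optimum: every (global) minimizer $(W,H)$ of (1) satisfies $\|W\|_F^2=E_W$ and $\|H\|_F^2=E_H$. Then the problem $$\min_{\boldsymbol z\in\mathbb R^m}\ \mathcal L(\sigma(\boldsymbol z),\boldsymbol y)\quad\text{s.t.}\quad \sum_{k=1}^m\Big|\sum_{l=1}^m z_l\,e^{-2\pi\mathrm i(k-1)(l-1)/m}\Big|\le\sqrt{E_WE_H}\tag{2}$$ is convex (its objective is a convex function on $\mathbb R^m$ and its feasible set is convex), and every minimizer $(W^*,H^*)$ of (1) has the following properties, where $Z^*=W^*H^*$. 1. $Z^*$ is circulant, $Z^*_{:,j}=\Pi^{j-1}\boldsymbol z^*$ for $j=1,\dots,m$, and its generating vector $\boldsymbol z^*$ is a minimizer of (2). 2. $W^*(W^*)^\top=\sqrt{E_W/E_H}\,\big(Z^*(Z^*)^\top\big)^{1/2}$ and $(H^*)^\top H^*=\sqrt{E_H/E_W}\,\big(Z^*(Z^*)^\top\big)^{1/2}$, where $(\cdot)^{1/2}$ is the positive semidefinite square root. 3. $\big(Z^*(Z^*)^\top\big)^{1/2}$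 is circulant, and hence so are $W^*(W^*)^\top$ and $(H^*)^\top H^*$. -/

import Mathlib

open scoped Matrix MatrixOrder

namespace LayerPeeled

noncomputable section

/-! ### The constrained layer-peeled model -/

/-- The softmax function `σ(z)ᵢ = exp zᵢ / ∑ₖ exp zₖ`. -/
def softmax {m : ℕ} (z : Fin m → ℝ) : Fin m → ℝ :=
  fun i => Real.exp (z i) / ∑ k, Real.exp (z k)

/-- The cross-entropy loss `𝓛(q, p) = -∑ᵢ pᵢ log qᵢ`. -/
def crossEntropy {m : ℕ} (q p : Fin m → ℝ) : ℝ :=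
  -∑ i, p i * Real.log (q i)

section Frobenius

attribute [local instance] Matrix.frobeniusNormedAddCommGroup

/-- The Frobenius norm of a real matrix. -/
def frobeniusNorm {m n : ℕ} (A : Matrix (Fin m) (Fin n) ℝ) : ℝ := ‖A‖

theorem frobeniusNorm_sq {m n : ℕ} (A : Matrix (Fin m) (Fin n) ℝ) :
    frobeniusNorm A ^ 2 = ∑ i, ∑ j, A i j ^ 2 := by
  have h : (0 : ℝ) ≤ ∑ i, ∑ j, A i j ^ 2 :=
    Finset.sum_nonneg fun i _ => Finset.sum_nonneg fun j _ => sq_nonneg _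
  have h2 : frobeniusNorm A = Real.sqrt (∑ i, ∑ j, A i j ^ 2) := by
    simp [frobeniusNorm, Matrix.frobenius_norm_def, Real.sqrt_eq_rpow]
  rw [h2, Real.sq_sqrt h]

end Frobenius

/-- The objective `𝒥(W, H; Y)`: the sum over the columns `j` of the cross-entropy between
the softmax of the `j`-th column of `W * H` and the `j`-th column of `Y`. -/
def objective {m n d : ℕ} (Y : Matrix (Fin m) (Fin n) ℝ)
    (W : Matrix (Fin m) (Fin d) ℝ) (H : Matrix (Fin d) (Fin n) ℝ) : ℝ :=
  ∑ j, crossEntropy (softmax ((W * H).col j)) (Y.col j)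

/-- The pairs `(W, H)` with `‖W‖_F² ≤ E_W` and `‖H‖_F² ≤ E_H`. -/
def feasibleSet (m n d : ℕ) (EW EH : ℝ) :
    Set (Matrix (Fin m) (Fin d) ℝ × Matrix (Fin d) (Fin n) ℝ) :=
  {p | frobeniusNorm p.1 ^ 2 ≤ EW ∧ frobeniusNorm p.2 ^ 2 ≤ EH}

/-- `(W, H)` is a global minimizer of the constrained layer-peeled problem with target `Y`. -/
def IsMinimizer {m n d : ℕ} (Y : Matrix (Fin m) (Fin n) ℝ) (EW EH : ℝ)
    (W : Matrix (Fin m) (Fin d) ℝ) (H : Matrix (Fin d) (Fin n) ℝ) : Prop :=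
  (W, H) ∈ feasibleSet m n d EW EH ∧
    IsMinOn (fun p => objective Y p.1 p.2) (feasibleSet m n d EW EH) (W, H)

/-- Both norm constraints are active at every minimizer with inner dimension `d`. -/
def ActiveConstraints {m n : ℕ} (d : ℕ) (Y : Matrix (Fin m) (Fin n) ℝ) (EW EH : ℝ) : Prop :=
  ∀ (W : Matrix (Fin m) (Fin d) ℝ) (H : Matrix (Fin d) (Fin n) ℝ),
    IsMinimizer Y EW EH W H → frobeniusNorm W ^ 2 = EW ∧ frobeniusNorm H ^ 2 = EH

/-! ### Cyclic shifts and circulant matrices -/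

/-- The one-step cyclic-shift matrix `Π`, with
`Π (y₁, …, y_m)ᵀ = (y_m, y₁, …, y_{m-1})ᵀ`. -/
def cyclicShift (m : ℕ) : Matrix (Fin m) (Fin m) ℝ :=
  Matrix.of fun i j => if (i : ℕ) = ((j : ℕ) + 1) % m then 1 else 0

/-- The matrix `[a, Π a, …, Π^(m-1) a]`. -/
def shiftMatrix {m : ℕ} (a : Fin m → ℝ) : Matrix (Fin m) (Fin m) ℝ :=
  Matrix.of fun i j => ((cyclicShift m ^ (j : ℕ)) *ᵥ a) i

/-- A real square matrix is circulant if its columns are the successive cyclic shifts of a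
generating vector. -/
def IsCirculant {m : ℕ} (A : Matrix (Fin m) (Fin m) ℝ) : Prop :=
  ∃ a : Fin m → ℝ, A = shiftMatrix a

theorem cyclicShift_mulVec {m : ℕ} [NeZero m] (a : Fin m → ℝ) (i : Fin m) :
    (cyclicShift m *ᵥ a) i = a (i - 1) := by
  have key : ∀ j : Fin m, (i : ℕ) = ((j : ℕ) + 1) % m ↔ j = i - 1 := by
    intro j
    rw [eq_sub_iff_add_eq, Fin.ext_iff, Fin.val_add, Fin.val_one', Nat.add_mod_mod]
    exact eq_comm
  simp [Matrix.mulVec, dotProduct, cyclicShift, key]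

/-- `[a, Π a, …, Π^(m-1) a]` has entries `a (i - j)`, indices being taken modulo `m`. -/
theorem shiftMatrix_eq_circulant {m : ℕ} (a : Fin m → ℝ) :
    shiftMatrix a = Matrix.circulant a := by
  rcases Nat.eq_zero_or_pos m with rfl | hm
  · ext i
    exact i.elim0
  have : NeZero m := ⟨hm.ne'⟩
  have key : ∀ (n : ℕ) (i : Fin m),
      ((cyclicShift m ^ n) *ᵥ a) i = a (i - Fin.ofNat m n) := by
    intro n
    induction n with
    | zero => intro i; simp
    | succ n ih =>
      intro i
      rw [pow_succ', ← Matrix.mulVec_mulVec, cyclicShift_mulVec, ih]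
      congr 1
      rw [sub_sub]
      congr 1
      ext
      simp [Fin.val_add, add_comm]
  ext i j
  simp [shiftMatrix, key]

/-! ### The reduced program -/

/-- The loss `z ↦ 𝓛(σ(z), y)` of a single logit vector. -/
def reducedObjective {m : ℕ} (y z : Fin m → ℝ) : ℝ :=
  crossEntropy (softmax z) y

/-- The vectors `z` whose discrete Fourier coefficients satisfy
`∑ₖ |∑ₗ zₗ exp(-2πi k l / m)| ≤ √(E_W E_H)`, with `k, l` running over `0, …, m-1`. -/
def reducedFeasibleSet (m : ℕ) (EW EH : ℝ) : Set (Fin m → ℝ) :=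
  {z | ∑ k : Fin m, ‖∑ l : Fin m, (z l : ℂ) *
      Complex.exp (-2 * Real.pi * Complex.I * ((k : ℕ) : ℂ) * ((l : ℕ) : ℂ) / (m : ℂ))‖
        ≤ Real.sqrt (EW * EH)}

end

end LayerPeeled

namespace LayerPeeled

/-! ### The cross-entropy of a softmax as a function of the logits -/

/-! The loss sees only `Z = W * H`. Since `m ≤ d`, a factorization over any finite inner index
compresses to inner dimension `d`, and rescaling makes only the product of the two norms matter
(`exists_feasible_factorization`). Active constraints then say that no optimal `Z` has a
factorization with smaller product (`IsMinimizer.le_sqSum_mul_sqSum`).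

Perturbing a minimizer exploits this. Centering `W` shows that the columns of `Z` have mean zero;
with strict convexity of log-sum-exp modulo constants this makes `Z` unique
(`IsMinimizer.mul_eq_mul`). Stretching one inner direction gives balancedness
(`IsMinimizer.balanced`), from which the Gram matrices are square roots. Shifting rows and columns
together permutes the minimizers, so uniqueness makes `Z`, and with it the Gram matrices, circulant.

For a circulant matrix the least product of Frobenius norms of two factors is the sum of the moduli
of its Fourier coefficients (`sum_norm_fourierCoeff_le`, `exists_factorization_shiftMatrix`). This
identifies the constraint of the reduced program. -/

theorem sum_exp_pos {m : ℕ} [NeZero m] (z : Fin m → ℝ) : 0 < ∑ k, Real.exp (z k) :=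
  Finset.sum_pos (fun _ _ => Real.exp_pos _) Finset.univ_nonempty

theorem softmax_pos {m : ℕ} [NeZero m] (z : Fin m → ℝ) (i : Fin m) : 0 < softmax z i :=
  div_pos (Real.exp_pos _) (sum_exp_pos z)

theorem sum_softmax {m : ℕ} [NeZero m] (z : Fin m → ℝ) : ∑ i, softmax z i = 1 := by
  simp only [softmax, ← Finset.sum_div]
  exact div_self (sum_exp_pos z).ne'

theorem reducedObjective_eq {m : ℕ} [NeZero m] {y : Fin m → ℝ} (hy : ∑ i, y i = 1)
    (z : Fin m → ℝ) :
    reducedObjective y z = Real.log (∑ k, Real.exp (z k)) - ∑ i, y i * z i := by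
  have h : ∀ i, y i * Real.log (softmax z i)
      = y i * z i - y i * Real.log (∑ k, Real.exp (z k)) := fun i => by
    rw [softmax, Real.log_div (Real.exp_pos _).ne' (sum_exp_pos z).ne', Real.log_exp, mul_sub]
  simp only [reducedObjective, crossEntropy, h, Finset.sum_sub_distrib, ← Finset.sum_mul, hy]
  ring

theorem reducedObjective_add_const {m : ℕ} [NeZero m] {y : Fin m → ℝ} (hy : ∑ i, y i = 1)
    (z : Fin m → ℝ) (c : ℝ) :
    reducedObjective y (fun i => z i + c) = reducedObjective y z := by
  rw [reducedObjective_eq hy, reducedObjective_eq hy]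
  simp only [Real.exp_add, ← Finset.sum_mul, mul_add, Finset.sum_add_distrib, hy]
  rw [Real.log_mul (sum_exp_pos z).ne' (Real.exp_pos _).ne', Real.log_exp]
  ring

theorem reducedObjective_comp_equiv {m : ℕ} (e : Fin m ≃ Fin m) (y z : Fin m → ℝ) :
    reducedObjective (y ∘ e) (z ∘ e) = reducedObjective y z := by
  have h : ∑ k, Real.exp (z (e k)) = ∑ k, Real.exp (z k) :=
    Equiv.sum_comp e fun k => Real.exp (z k)
  simp only [reducedObjective, crossEntropy, softmax, Function.comp_apply, h]
  rw [Equiv.sum_comp e fun i => y i * Real.log (Real.exp (z i) / ∑ k, Real.exp (z k))]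

/-- The log-sum-exp function lies above its tangent planes, and touches them only along the
direction of the constant vectors. -/
theorem logSumExp_tangent {m : ℕ} [NeZero m] (z w : Fin m → ℝ) :
    ∑ i, softmax w i * (z i - w i) ≤
        Real.log (∑ k, Real.exp (z k)) - Real.log (∑ k, Real.exp (w k)) ∧
      (∑ i, softmax w i * (z i - w i) =
          Real.log (∑ k, Real.exp (z k)) - Real.log (∑ k, Real.exp (w k)) →
        ∃ c, ∀ i, z i - w i = c) := by
  -- This `c` makes the weights `softmax w i * exp (z i - w i - c)` sum to one. The claim is then
  -- the average of `x + 1 ≤ exp x`, which is strict unless `x = 0`.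
  set c := Real.log (∑ k, Real.exp (z k)) - Real.log (∑ k, Real.exp (w k)) with hc
  have hexp : Real.exp c = (∑ k, Real.exp (z k)) / ∑ k, Real.exp (w k) := by
    rw [hc, Real.exp_sub, Real.exp_log (sum_exp_pos z), Real.exp_log (sum_exp_pos w)]
  have hsum : ∑ i, softmax w i * Real.exp (z i - w i - c) = 1 := by
    have h : ∀ i, softmax w i * Real.exp (z i - w i - c)
        = Real.exp (z i) / ∑ k, Real.exp (z k) := fun i => by
      have h1 := (sum_exp_pos z).ne'
      have h2 := (sum_exp_pos w).ne'
      rw [Real.exp_sub, Real.exp_sub, hexp, softmax]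
      field_simp
    simp only [h, ← Finset.sum_div]
    exact div_self (sum_exp_pos z).ne'
  have hlin : ∑ i, softmax w i * (z i - w i - c + 1)
      = ∑ i, softmax w i * (z i - w i) - c + 1 := by
    have h : ∀ i, softmax w i * (z i - w i - c + 1)
        = softmax w i * (z i - w i) - softmax w i * c + softmax w i := fun i => by ring
    simp only [h, Finset.sum_add_distrib, Finset.sum_sub_distrib, ← Finset.sum_mul, sum_softmax]
    ring
  have hle : ∀ i, softmax w i * (z i - w i - c + 1) ≤ softmax w i * Real.exp (z i - w i - c) :=
    fun i => mul_le_mul_of_nonneg_left (Real.add_one_le_exp _) (softmax_pos w i).le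
  constructor
  · have := Finset.sum_le_sum fun i (_ : i ∈ Finset.univ) => hle i
    rw [hsum, hlin] at this
    linarith
  · intro heq
    refine ⟨c, fun i => ?_⟩
    have h : ∑ i, softmax w i * (z i - w i - c + 1)
        = ∑ i, softmax w i * Real.exp (z i - w i - c) := by
      rw [hsum, hlin, heq]; ring
    have hi := (Finset.sum_eq_sum_iff_of_le fun i _ => hle i).1 h i (Finset.mem_univ i)
    by_contra hne
    have hlt := Real.add_one_lt_exp (sub_ne_zero.2 hne)
    exact (mul_lt_mul_of_pos_left hlt (softmax_pos w i)).ne hi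

/-- Average the two tangent inequalities at the convex combination; their linear terms cancel. -/
theorem convexOn_reducedObjective {m : ℕ} [NeZero m] {y : Fin m → ℝ} (hy : ∑ i, y i = 1) :
    ConvexOn ℝ Set.univ (reducedObjective y) := by
  refine ⟨convex_univ, fun z _ w _ a b ha hb hab => ?_⟩
  simp only [reducedObjective_eq hy, smul_eq_mul]
  set u := a • z + b • w with hu
  have h1 := mul_le_mul_of_nonneg_left (logSumExp_tangent z u).1 ha
  have h2 := mul_le_mul_of_nonneg_left (logSumExp_tangent w u).1 hb
  have h3 : a * ∑ i, softmax u i * (z i - u i) + b * ∑ i, softmax u i * (w i - u i) = 0 := by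
    rw [Finset.mul_sum, Finset.mul_sum, ← Finset.sum_add_distrib]
    refine Finset.sum_eq_zero fun i _ => ?_
    have : u i = a * z i + b * w i := by simp [hu]
    rw [this]
    linear_combination -softmax u i * (a * z i + b * w i) * hab
  have h4 : ∑ i, y i * u i = a * ∑ i, y i * z i + b * ∑ i, y i * w i := by
    rw [Finset.mul_sum, Finset.mul_sum, ← Finset.sum_add_distrib]
    refine Finset.sum_congr rfl fun i _ => ?_
    simp only [hu, Pi.add_apply, Pi.smul_apply, smul_eq_mul]; ring
  have hb' : b = 1 - a := by linarith
  rw [h4]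
  subst hb'
  linarith

/-- Midpoint strict convexity modulo constant vectors. -/
theorem exists_const_of_reducedObjective_midpoint {m : ℕ} [NeZero m] {y : Fin m → ℝ}
    (hy : ∑ i, y i = 1) (z w : Fin m → ℝ)
    (h : (reducedObjective y z + reducedObjective y w) / 2 ≤
      reducedObjective y (fun i => (z i + w i) / 2)) :
    ∃ c, ∀ i, z i - w i = c := by
  simp only [reducedObjective_eq hy] at h
  set u : Fin m → ℝ := fun i => (z i + w i) / 2 with hu
  have h1 := logSumExp_tangent z u
  have h2 := logSumExp_tangent w u
  have h3 : ∑ i, softmax u i * (z i - u i) + ∑ i, softmax u i * (w i - u i) = 0 := by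
    rw [← Finset.sum_add_distrib]
    exact Finset.sum_eq_zero fun i _ => by simp only [hu]; ring
  have h4 : ∑ i, y i * u i = (∑ i, y i * z i + ∑ i, y i * w i) / 2 := by
    rw [← Finset.sum_add_distrib, Finset.sum_div]
    exact Finset.sum_congr rfl fun i _ => by simp only [hu]; ring
  -- The gaps in the two tangent inequalities at the midpoint are nonnegative and, by `h`, have sum
  -- at most zero; so the first is an equality.
  obtain ⟨c, hc⟩ := h1.2 (le_antisymm h1.1 (by linarith [h2.1]))
  refine ⟨2 * c, fun i => ?_⟩
  rw [← hc i]
  simp only [hu]; ring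

theorem convex_reducedFeasibleSet (m : ℕ) (EW EH : ℝ) : Convex ℝ (reducedFeasibleSet m EW EH) := by
  intro z hz w hw a b ha hb hab
  simp only [reducedFeasibleSet, Set.mem_ofPred_eq] at hz hw ⊢
  set χ : Fin m → Fin m → ℂ := fun k l =>
    Complex.exp (-2 * Real.pi * Complex.I * ((k : ℕ) : ℂ) * ((l : ℕ) : ℂ) / (m : ℂ))
  have h : ∀ k, ‖∑ l, (((a • z + b • w) l : ℝ) : ℂ) * χ k l‖ ≤
      a * ‖∑ l, (z l : ℂ) * χ k l‖ + b * ‖∑ l, (w l : ℂ) * χ k l‖ := fun k => by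
    have : ∑ l, (((a • z + b • w) l : ℝ) : ℂ) * χ k l
        = (a : ℂ) * (∑ l, (z l : ℂ) * χ k l) + (b : ℂ) * ∑ l, (w l : ℂ) * χ k l := by
      rw [Finset.mul_sum, Finset.mul_sum, ← Finset.sum_add_distrib]
      refine Finset.sum_congr rfl fun l _ => ?_
      simp only [Pi.add_apply, Pi.smul_apply, smul_eq_mul]; push_cast; ring
    rw [this]
    refine (norm_add_le _ _).trans (le_of_eq ?_)
    rw [norm_mul, norm_mul, Complex.norm_of_nonneg ha, Complex.norm_of_nonneg hb]
  refine (Finset.sum_le_sum fun k _ => h k).trans ?_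
  rw [Finset.sum_add_distrib, ← Finset.mul_sum, ← Finset.mul_sum]
  have h1 := mul_le_mul_of_nonneg_left hz ha
  have h2 := mul_le_mul_of_nonneg_left hw hb
  refine (add_le_add h1 h2).trans (le_of_eq ?_)
  rw [← add_mul, hab, one_mul]

/-! ### Factorizations with a prescribed inner dimension -/

/-- The squared Frobenius norm. -/
def sqSum {ι κ : Type*} [Fintype ι] [Fintype κ] (A : Matrix ι κ ℝ) : ℝ := ∑ i, ∑ j, A i j ^ 2

theorem sqSum_nonneg {ι κ : Type*} [Fintype ι] [Fintype κ] (A : Matrix ι κ ℝ) : 0 ≤ sqSum A :=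
  Finset.sum_nonneg fun _ _ => Finset.sum_nonneg fun _ _ => sq_nonneg _

theorem sqSum_smul {ι κ : Type*} [Fintype ι] [Fintype κ] (c : ℝ) (A : Matrix ι κ ℝ) :
    sqSum (c • A) = c ^ 2 * sqSum A := by
  simp [sqSum, mul_pow, Finset.mul_sum]

theorem sqSum_comm {ι κ : Type*} [Fintype ι] [Fintype κ] (A : Matrix ι κ ℝ) :
    sqSum A = ∑ j, ∑ i, A i j ^ 2 := Finset.sum_comm

theorem eq_zero_of_sqSum_eq_zero {ι κ : Type*} [Fintype ι] [Fintype κ] {A : Matrix ι κ ℝ}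
    (h : sqSum A = 0) : A = 0 := by
  ext i j
  have h1 := (Finset.sum_eq_zero_iff_of_nonneg
    fun i _ => Finset.sum_nonneg fun j _ => sq_nonneg (A i j)).1 h i (Finset.mem_univ i)
  have h2 := (Finset.sum_eq_zero_iff_of_nonneg
    fun j _ => sq_nonneg (A i j)).1 h1 j (Finset.mem_univ j)
  simpa using h2

/-- A matrix with `m` rows is unchanged by the projection onto its row space, whose dimension is
at most `m`; so it factors through a `d`-dimensional partial isometry as soon as `m ≤ d`. -/
theorem exists_partial_isometry {m d : ℕ} (hd : m ≤ d) {ι : Type*} [Fintype ι]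
    (W : Matrix (Fin m) ι ℝ) :
    ∃ v : Fin d → ι → ℝ,
      (∀ i a, ∑ k, (∑ b, v k b * W i b) * v k a = W i a) ∧
      (∀ i, ∑ k, (∑ b, v k b * W i b) ^ 2 = ∑ b, W i b ^ 2) ∧
      (∀ x : ι → ℝ, ∑ k, (∑ b, v k b * x b) ^ 2 ≤ ∑ b, x b ^ 2) := by
  classical
  set row : Fin m → EuclideanSpace ℝ ι := fun i => WithLp.toLp 2 (W i) with hrow
  set R : Submodule ℝ (EuclideanSpace ℝ ι) := Submodule.span ℝ (Set.range row) with hR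
  have hr : Module.finrank ℝ R ≤ d := by
    refine le_trans ?_ hd
    simpa [Set.finrank] using finrank_range_le_card (R := ℝ) row
  set b := stdOrthonormalBasis ℝ R
  set e : Fin (Module.finrank ℝ R) → Fin d := Fin.castLE hr
  have he : Function.Injective e := Fin.castLE_injective hr
  -- An orthonormal basis of the row space, padded by zero vectors to length `d`. Expansion and
  -- Parseval hold for the rows, Bessel's inequality for all vectors.
  set v : Fin d → EuclideanSpace ℝ ι :=
    Function.extend e (fun k => (b k : EuclideanSpace ℝ ι)) 0 with hv
  have hve : ∀ k, v (e k) = b k := fun k => he.extend_apply _ _ k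
  have hv0 : ∀ k, k ∉ Set.range e → v k = 0 := fun k hk => by
    rw [hv, Function.extend_apply' _ _ _ (by simpa using hk)]; rfl
  have hin : ∀ k (x : EuclideanSpace ℝ ι), ∑ a, v k a * x a = inner ℝ (v k) x := fun k x => by
    simp [PiLp.inner_apply, mul_comm]
  have hmem : ∀ i, row i ∈ R := fun i => Submodule.subset_span ⟨i, rfl⟩
  have hnorm : ∀ x : EuclideanSpace ℝ ι, ‖x‖ ^ 2 = ∑ a, x a ^ 2 := fun x => by
    simp [EuclideanSpace.norm_sq_eq]
  have hsum : ∀ x : EuclideanSpace ℝ ι, ∑ k, (inner ℝ (v k) x : ℝ) ^ 2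
      = ∑ k, ‖(inner ℝ (b k : EuclideanSpace ℝ ι) x : ℝ)‖ ^ 2 := fun x => by
    symm
    refine Fintype.sum_of_injective e he _ _ (fun k hk => by simp [hv0 k hk]) fun k => ?_
    simp [hve]
  refine ⟨fun k a => v k a, fun i a => ?_, fun i => ?_, fun x => ?_⟩
  · have h1 : ∑ k, (inner ℝ (v k) (row i) : ℝ) • v k = row i := by
      have h2 := congrArg (fun x : R => (x : EuclideanSpace ℝ ι)) (b.sum_repr' ⟨row i, hmem i⟩)
      simp only [Submodule.coe_sum, Submodule.coe_smul, Submodule.coe_inner] at h2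
      rw [← h2]
      symm
      refine Fintype.sum_of_injective e he _ _ (fun k hk => by simp [hv0 k hk]) fun k => ?_
      rw [hve, h2]
    have h3 := congrArg (fun x : EuclideanSpace ℝ ι => x a) h1
    simp only [← hin] at h3
    simpa [hrow] using h3
  · have h1 := b.sum_sq_norm_inner_right ⟨row i, hmem i⟩
    simp only [Submodule.coe_inner] at h1
    rw [← hsum] at h1
    simp only [← hin, Submodule.coe_norm, hnorm] at h1
    simpa [hrow] using h1
  · have h0 : Orthonormal ℝ fun k => (b k : EuclideanSpace ℝ ι) :=
      b.orthonormal.comp_linearIsometry R.subtypeₗᵢ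
    have h1 := h0.sum_inner_products_le (WithLp.toLp 2 x) (s := Finset.univ)
    rw [← hsum, hnorm] at h1
    simpa [← hin] using h1

/-- Insert the projection onto the row space of `W` between the factors: it fixes `W` and can only
shrink `H`. -/
theorem exists_factorization {m n d : ℕ} (hd : m ≤ d) {ι : Type*} [Fintype ι]
    (W : Matrix (Fin m) ι ℝ) (H : Matrix ι (Fin n) ℝ) :
    ∃ (W' : Matrix (Fin m) (Fin d) ℝ) (H' : Matrix (Fin d) (Fin n) ℝ),
      W' * H' = W * H ∧ sqSum W' = sqSum W ∧ sqSum H' ≤ sqSum H := by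
  obtain ⟨v, h1, h2, h3⟩ := exists_partial_isometry hd W
  refine ⟨Matrix.of fun i k => ∑ b, v k b * W i b, Matrix.of fun k j => ∑ b, v k b * H b j,
    ?_, ?_, ?_⟩
  · ext i j
    simp only [Matrix.mul_apply, Matrix.of_apply]
    have h4 : ∀ a, W i a * H a j = ∑ k, (∑ b, v k b * W i b) * (v k a * H a j) := fun a => by
      conv_lhs => rw [← h1 i a, Finset.sum_mul]
      exact Finset.sum_congr rfl fun k _ => mul_assoc _ _ _
    rw [Finset.sum_congr rfl fun a _ => h4 a, Finset.sum_comm]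
    exact Finset.sum_congr rfl fun k _ => Finset.mul_sum _ _ _
  · simp only [sqSum, Matrix.of_apply, h2]
  · rw [sqSum_comm, sqSum_comm]
    exact Finset.sum_le_sum fun j _ => h3 fun b => H b j

/-- A product of two matrices has a factorization with inner dimension `d` that meets the norm
constraints, as soon as the product of the squared norms is at most `E_W E_H`. -/
theorem exists_feasible_factorization {m n d : ℕ} (hd : m ≤ d) {ι : Type*} [Fintype ι]
    {EW EH : ℝ} (hEW : 0 < EW) (hEH : 0 < EH)
    (W : Matrix (Fin m) ι ℝ) (H : Matrix ι (Fin n) ℝ) (h : sqSum W * sqSum H ≤ EW * EH) :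
    ∃ (W' : Matrix (Fin m) (Fin d) ℝ) (H' : Matrix (Fin d) (Fin n) ℝ),
      W' * H' = W * H ∧ sqSum W' ≤ EW ∧ sqSum H' ≤ EH ∧
        EW * sqSum H' ≤ sqSum W * sqSum H := by
  obtain ⟨W₁, H₁, hmul, hW, hH⟩ := exists_factorization hd W H
  rcases (sqSum_nonneg W).eq_or_lt with h0 | hpos
  · refine ⟨0, 0, ?_, ?_, ?_, ?_⟩
    · rw [eq_zero_of_sqSum_eq_zero h0.symm]; simp
    · simpa [sqSum] using hEW.le
    · simpa [sqSum] using hEH.le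
    · rw [← h0]; simp [sqSum]
  -- Rescale so that the left factor has squared norm exactly `EW`; any slack in the product then
  -- goes to the right factor.
  · have hc : 0 < EW / sqSum W := div_pos hEW hpos
    have hs := (Real.sqrt_pos.2 hc).ne'
    have key : EW * sqSum ((Real.sqrt (EW / sqSum W))⁻¹ • H₁) ≤ sqSum W * sqSum H := by
      rw [sqSum_smul, inv_pow, Real.sq_sqrt hc.le, inv_div, ← mul_assoc,
        mul_div_cancel₀ _ hEW.ne']
      exact mul_le_mul_of_nonneg_left hH hpos.le
    refine ⟨Real.sqrt (EW / sqSum W) • W₁, (Real.sqrt (EW / sqSum W))⁻¹ • H₁, ?_, ?_, ?_, key⟩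
    · rw [Matrix.smul_mul, Matrix.mul_smul, smul_smul, mul_inv_cancel₀ hs, one_smul, hmul]
    · rw [sqSum_smul, Real.sq_sqrt hc.le, hW, div_mul_cancel₀ _ hpos.ne']
    · exact le_of_mul_le_mul_left (key.trans h) hEW

/-! ### Consequences of minimality and activeness -/

/-- The objective as a function of the logit matrix. -/
noncomputable def logitLoss {m n : ℕ} (Y Z : Matrix (Fin m) (Fin n) ℝ) : ℝ :=
  ∑ j, reducedObjective (Y.col j) (Z.col j)

theorem frobeniusNorm_sq_eq_sqSum {m n : ℕ} (A : Matrix (Fin m) (Fin n) ℝ) :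
    frobeniusNorm A ^ 2 = sqSum A := frobeniusNorm_sq A

theorem isMinimizer_iff {m n d : ℕ} {Y : Matrix (Fin m) (Fin n) ℝ} {EW EH : ℝ}
    {W : Matrix (Fin m) (Fin d) ℝ} {H : Matrix (Fin d) (Fin n) ℝ} :
    IsMinimizer Y EW EH W H ↔ (sqSum W ≤ EW ∧ sqSum H ≤ EH) ∧
      ∀ (W' : Matrix (Fin m) (Fin d) ℝ) (H' : Matrix (Fin d) (Fin n) ℝ),
        sqSum W' ≤ EW → sqSum H' ≤ EH → logitLoss Y (W * H) ≤ logitLoss Y (W' * H') := by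
  simp only [IsMinimizer, feasibleSet, isMinOn_iff, Set.mem_ofPred_eq, Prod.forall,
    frobeniusNorm_sq_eq_sqSum, and_imp]
  rfl

section Minimizer

variable {m n d : ℕ} {Y : Matrix (Fin m) (Fin n) ℝ} {EW EH : ℝ}
  {W : Matrix (Fin m) (Fin d) ℝ} {H : Matrix (Fin d) (Fin n) ℝ}

/-- Allowing any finite inner index admits stacked factors and real forms of complex factors as
competitors. -/
theorem IsMinimizer.logitLoss_le (hd : m ≤ d) (hEW : 0 < EW) (hEH : 0 < EH)
    (hmin : IsMinimizer Y EW EH W H) {ι : Type*} [Fintype ι]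
    (W' : Matrix (Fin m) ι ℝ) (H' : Matrix ι (Fin n) ℝ) (h : sqSum W' * sqSum H' ≤ EW * EH) :
    logitLoss Y (W * H) ≤ logitLoss Y (W' * H') := by
  obtain ⟨W₁, H₁, hmul, hW, hH, -⟩ := exists_feasible_factorization hd hEW hEH W' H' h
  rw [← hmul]
  exact (isMinimizer_iff.1 hmin).2 W₁ H₁ hW hH

/-- When the constraints are active, no optimal logit matrix has a cheaper factorization. -/
theorem IsMinimizer.le_sqSum_mul_sqSum (hd : m ≤ d) (hEW : 0 < EW) (hEH : 0 < EH)
    (hactive : ActiveConstraints d Y EW EH)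
    (hmin : IsMinimizer Y EW EH W H) {ι : Type*} [Fintype ι]
    (W' : Matrix (Fin m) ι ℝ) (H' : Matrix ι (Fin n) ℝ)
    (hle : logitLoss Y (W' * H') ≤ logitLoss Y (W * H)) :
    EW * EH ≤ sqSum W' * sqSum H' := by
  by_contra! hlt
  obtain ⟨W₁, H₁, hmul, hW, hH, hstrict⟩ :=
    exists_feasible_factorization hd hEW hEH W' H' hlt.le
  -- The cheaper factorization would itself be a minimizer, with an inactive constraint on `H₁`.
  have hmin₁ : IsMinimizer Y EW EH W₁ H₁ := isMinimizer_iff.2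
    ⟨⟨hW, hH⟩, fun W₂ H₂ hW₂ hH₂ => by
      rw [hmul]; exact hle.trans ((isMinimizer_iff.1 hmin).2 W₂ H₂ hW₂ hH₂)⟩
  have := (hactive W₁ H₁ hmin₁).2
  rw [frobeniusNorm_sq_eq_sqSum] at this
  rw [this] at hstrict
  linarith

theorem IsMinimizer.sqSum_eq (hactive : ActiveConstraints d Y EW EH)
    (hmin : IsMinimizer Y EW EH W H) : sqSum W = EW ∧ sqSum H = EH := by
  simpa only [frobeniusNorm_sq_eq_sqSum] using hactive W H hmin

/-- The columns of an optimal logit matrix have mean zero. -/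
theorem IsMinimizer.sum_col_eq_zero [NeZero m] (hd : m ≤ d) (hEW : 0 < EW) (hEH : 0 < EH)
    (hY : ∀ j, ∑ i, Y.col j i = 1) (hactive : ActiveConstraints d Y EW EH)
    (hmin : IsMinimizer Y EW EH W H) (j : Fin n) : ∑ i, (W * H) i j = 0 := by
  have hm : (0 : ℝ) < m := Nat.cast_pos.2 (Nat.pos_of_neZero m)
  -- Subtracting the column means of `W` moves each logit column by a constant, which softmax
  -- ignores, and lowers `sqSum W` by `m * ∑ k, μ k ^ 2`.
  set μ : Fin d → ℝ := fun k => (∑ i, W i k) / m with hμ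
  set W' : Matrix (Fin m) (Fin d) ℝ := Matrix.of fun i k => W i k - μ k with hW'
  have hloss : logitLoss Y (W' * H) = logitLoss Y (W * H) := by
    refine Finset.sum_congr rfl fun j _ => ?_
    rw [← reducedObjective_add_const (hY j) ((W * H).col j) (-∑ k, μ k * H k j)]
    congr 1
    ext i
    simp [Matrix.mul_apply, hW', add_mul, Finset.sum_add_distrib, sub_eq_add_neg]
  have hle := hmin.le_sqSum_mul_sqSum hd hEW hEH hactive W' H hloss.le
  obtain ⟨hW, hH⟩ := hmin.sqSum_eq hactive
  rw [hH] at hle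
  have hle' : EW ≤ sqSum W' := le_of_mul_le_mul_right hle hEH
  have hsq : sqSum W' = sqSum W - m * ∑ k, μ k ^ 2 := by
    rw [sqSum_comm, sqSum_comm, Finset.mul_sum, ← Finset.sum_sub_distrib]
    refine Finset.sum_congr rfl fun k _ => ?_
    have h1 : ∑ i, W i k = m * μ k := by simp only [hμ]; field_simp
    have h2 : ∀ i, (W i k - μ k) ^ 2 = W i k ^ 2 - W i k * (2 * μ k) + μ k ^ 2 := fun i => by ring
    simp only [hW', Matrix.of_apply, h2, Finset.sum_add_distrib, Finset.sum_sub_distrib,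
      ← Finset.sum_mul, h1, Finset.sum_const, Finset.card_univ, Fintype.card_fin, nsmul_eq_mul]
    ring
  have h0 : ∑ k, μ k ^ 2 = 0 :=
    le_antisymm (nonpos_of_mul_nonpos_right (by linarith) hm)
      (Finset.sum_nonneg fun _ _ => sq_nonneg _)
  have h1 : ∀ k, ∑ i, W i k = 0 := fun k => by
    have := (Finset.sum_eq_zero_iff_of_nonneg fun k _ => sq_nonneg (μ k)).1 h0 k
      (Finset.mem_univ k)
    have := pow_eq_zero_iff (two_ne_zero) |>.1 this
    simpa [hμ, hm.ne'] using this
  simp only [Matrix.mul_apply]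
  rw [Finset.sum_comm]
  simp [← Finset.sum_mul, h1]

/-- All minimizers share the same logit matrix. -/
theorem IsMinimizer.mul_eq_mul [NeZero m] (hd : m ≤ d) (hEW : 0 < EW) (hEH : 0 < EH)
    (hY : ∀ j, ∑ i, Y.col j i = 1) (hactive : ActiveConstraints d Y EW EH)
    (hmin : IsMinimizer Y EW EH W H)
    {W' : Matrix (Fin m) (Fin d) ℝ} {H' : Matrix (Fin d) (Fin n) ℝ}
    (hmin' : IsMinimizer Y EW EH W' H') : W * H = W' * H' := by
  have hm : (0 : ℝ) < m := Nat.cast_pos.2 (Nat.pos_of_neZero m)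
  obtain ⟨hW, hH⟩ := hmin.sqSum_eq hactive
  obtain ⟨hW', hH'⟩ := hmin'.sqSum_eq hactive
  -- The midpoint of the logit matrices factors through doubled inner dimension with squared norms
  -- `2 * EW` and `EH / 2`, so it is an admissible competitor.
  have hmid : Matrix.fromCols W W' * Matrix.fromRows ((1 / 2 : ℝ) • H) ((1 / 2 : ℝ) • H')
      = (1 / 2 : ℝ) • (W * H + W' * H') := by
    rw [Matrix.fromCols_mul_fromRows, Matrix.mul_smul, Matrix.mul_smul, smul_add]
  have hsqW : sqSum (Matrix.fromCols W W') = sqSum W + sqSum W' := by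
    simp [sqSum, Finset.sum_add_distrib]
  have hsqH : sqSum (Matrix.fromRows ((1 / 2 : ℝ) • H) ((1 / 2 : ℝ) • H'))
      = (1 / 2) ^ 2 * sqSum H + (1 / 2) ^ 2 * sqSum H' := by
    rw [← sqSum_smul, ← sqSum_smul]
    simp [sqSum]
  have h := hmin.logitLoss_le hd hEW hEH (Matrix.fromCols W W')
    (Matrix.fromRows ((1 / 2 : ℝ) • H) ((1 / 2 : ℝ) • H'))
    (by rw [hsqW, hsqH, hW, hW', hH, hH']; exact le_of_eq (by ring))
  rw [hmid] at h
  have heq : logitLoss Y (W * H) = logitLoss Y (W' * H') :=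
    le_antisymm (hmin.logitLoss_le hd hEW hEH W' H' (by rw [hW', hH']))
      (hmin'.logitLoss_le hd hEW hEH W H (by rw [hW, hH]))
  have hcol : ∀ j, reducedObjective (Y.col j) (((1 / 2 : ℝ) • (W * H + W' * H')).col j) ≤
      (reducedObjective (Y.col j) ((W * H).col j) +
        reducedObjective (Y.col j) ((W' * H').col j)) / 2 := fun j => by
    have h1 := (convexOn_reducedObjective (hY j)).2 (Set.mem_univ ((W * H).col j))
      (Set.mem_univ ((W' * H').col j)) (show (0 : ℝ) ≤ 1 / 2 by norm_num)
      (show (0 : ℝ) ≤ 1 / 2 by norm_num) (by norm_num)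
    have h2 : ((1 / 2 : ℝ) • (W * H + W' * H')).col j
        = (1 / 2 : ℝ) • (W * H).col j + (1 / 2 : ℝ) • (W' * H').col j := by
      ext i; simp
    rw [h2]
    refine h1.trans (le_of_eq ?_)
    simp only [smul_eq_mul]; ring
  have hsum : ∑ j, reducedObjective (Y.col j) (((1 / 2 : ℝ) • (W * H + W' * H')).col j) =
      ∑ j, (reducedObjective (Y.col j) ((W * H).col j) +
        reducedObjective (Y.col j) ((W' * H').col j)) / 2 := by
    refine le_antisymm (Finset.sum_le_sum fun j _ => hcol j) ?_
    rw [← Finset.sum_div, Finset.sum_add_distrib]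
    simp only [logitLoss] at h heq
    linarith
  ext i j
  have hj := (Finset.sum_eq_sum_iff_of_le fun j _ => hcol j).1 hsum j (Finset.mem_univ j)
  have hfun : ((1 / 2 : ℝ) • (W * H + W' * H')).col j
      = fun i => ((W * H).col j i + (W' * H').col j i) / 2 := by
    ext i; simp; ring
  rw [hfun] at hj
  obtain ⟨c, hc⟩ := exists_const_of_reducedObjective_midpoint (hY j) _ _ hj.ge
  -- Zero column means remove the constant left free by strict convexity.
  have hs : ∑ i, ((W * H).col j i - (W' * H').col j i) = 0 := by
    rw [Finset.sum_sub_distrib]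
    simp only [Matrix.col_apply]
    rw [hmin.sum_col_eq_zero hd hEW hEH hY hactive j,
      hmin'.sum_col_eq_zero hd hEW hEH hY hactive j, sub_zero]
  simp only [hc, Finset.sum_const, Finset.card_univ, Fintype.card_fin, nsmul_eq_mul] at hs
  have hc0 : c = 0 := (mul_eq_zero.1 hs).resolve_left hm.ne'
  have := hc i
  rw [hc0] at this
  simpa [sub_eq_zero] using this

/-! ### Balancedness of the two factors -/

/-- Otherwise a small `b` of sign opposite to `p` makes the linear term win; `-p / (|p| + |q| + 1)`
is such a value and exceeds `-1`. -/
theorem eq_zero_of_forall_linear_add_sq_nonneg {p q : ℝ}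
    (h : ∀ b : ℝ, -1 < b → 0 ≤ b * p + b ^ 2 * q) : p = 0 := by
  by_contra hp
  have hD : 0 < |p| + |q| + 1 := by positivity
  have hpp : 0 < p ^ 2 := by positivity
  have h1 : -1 < -p / (|p| + |q| + 1) := by
    rw [lt_div_iff₀ hD]; linarith [le_abs_self p, abs_nonneg q]
  have h2 := h _ h1
  have h3 : -p / (|p| + |q| + 1) * p + (-p / (|p| + |q| + 1)) ^ 2 * q
      = -(p ^ 2 * (|p| + |q| + 1 - q)) / (|p| + |q| + 1) ^ 2 := by
    field_simp; ring
  rw [h3] at h2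
  have h4 : 0 < p ^ 2 * (|p| + |q| + 1 - q) :=
    mul_pos hpp (by linarith [le_abs_self q, abs_nonneg p])
  have h5 : -(p ^ 2 * (|p| + |q| + 1 - q)) / (|p| + |q| + 1) ^ 2 < 0 :=
    div_neg_of_neg_of_pos (by linarith) (by positivity)
  linarith

/-- Stretching `W` by `1 + s` along `v` and `H` by the inverse keeps `W * H`, so the product of
squared norms is minimal at `s = 0`. The identity is the first-order condition. -/
theorem IsMinimizer.balanced_of_unit (hd : m ≤ d) (hEW : 0 < EW) (hEH : 0 < EH)
    (hactive : ActiveConstraints d Y EW EH) (hmin : IsMinimizer Y EW EH W H)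
    (v : Fin d → ℝ) (hv : ∑ k, v k ^ 2 = 1) :
    EH * ∑ i, (∑ k, W i k * v k) ^ 2 = EW * ∑ j, (∑ k, v k * H k j) ^ 2 := by
  obtain ⟨hW, hH⟩ := hmin.sqSum_eq hactive
  set a : Fin m → ℝ := fun i => ∑ k, W i k * v k with ha
  set b : Fin n → ℝ := fun j => ∑ k, v k * H k j with hb
  set u := ∑ i, a i ^ 2 with hu
  set w := ∑ j, b j ^ 2 with hw
  have key : ∀ s : ℝ, -1 < s → EW * EH ≤ (EW + ((1 + s) ^ 2 - 1) * u) *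
      (EH + (((1 + s) ^ 2)⁻¹ - 1) * w) := fun s hs => by
    have hs' : (1 + s) ≠ 0 := by linarith
    set t : ℝ := (1 + s)⁻¹ - 1 with ht
    set W' : Matrix (Fin m) (Fin d) ℝ := Matrix.of fun i k => W i k + s * a i * v k with hW'
    set H' : Matrix (Fin d) (Fin n) ℝ := Matrix.of fun k j => H k j + t * v k * b j with hH'
    have hmul : W' * H' = W * H := by
      ext i j
      have h1 : ∀ k, W' i k * H' k j = W i k * H k j + W i k * v k * (t * b j)
          + (s * a i) * (v k * H k j) + s * t * a i * b j * v k ^ 2 := fun k => by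
        simp only [hW', hH', Matrix.of_apply]; ring
      simp only [Matrix.mul_apply, h1, Finset.sum_add_distrib, ← Finset.sum_mul,
        ← Finset.mul_sum, hv]
      change _ + a i * (t * b j) + s * a i * b j + _ = _
      have : s + t + s * t = 0 := by rw [ht]; field_simp; ring
      linear_combination a i * b j * this
    have hsW : sqSum W' = EW + ((1 + s) ^ 2 - 1) * u := by
      rw [← hW, sqSum, sqSum, hu, Finset.mul_sum, ← Finset.sum_add_distrib]
      refine Finset.sum_congr rfl fun i _ => ?_
      have h1 : ∀ k, W' i k ^ 2 = W i k ^ 2 + 2 * s * a i * (W i k * v k)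
          + s ^ 2 * a i ^ 2 * v k ^ 2 := fun k => by
        simp only [hW', Matrix.of_apply]; ring
      simp only [h1, Finset.sum_add_distrib, ← Finset.mul_sum, hv]
      change _ + 2 * s * a i * a i + _ = _
      ring
    have hsH : sqSum H' = EH + (((1 + s) ^ 2)⁻¹ - 1) * w := by
      have ht' : ((1 + s) ^ 2)⁻¹ - 1 = 2 * t + t ^ 2 := by rw [ht]; field_simp; ring
      rw [ht', ← hH, sqSum_comm, sqSum_comm, hw, Finset.mul_sum, ← Finset.sum_add_distrib]
      refine Finset.sum_congr rfl fun j _ => ?_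
      have h1 : ∀ k, H' k j ^ 2 = H k j ^ 2 + 2 * t * b j * (v k * H k j)
          + t ^ 2 * b j ^ 2 * v k ^ 2 := fun k => by
        simp only [hH', Matrix.of_apply]; ring
      simp only [h1, Finset.sum_add_distrib, ← Finset.mul_sum, hv]
      change _ + 2 * t * b j * b j + _ = _
      ring
    rw [← hsW, ← hsH]
    exact hmin.le_sqSum_mul_sqSum hd hEW hEH hactive W' H' (by rw [hmul])
  have h0 : EH * u - EW * w = 0 := by
    refine eq_zero_of_forall_linear_add_sq_nonneg (q := u * (EH - w)) fun x hx => ?_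
    have hx1 : 0 < 1 + x := by linarith
    -- Here `(1 + s) ^ 2 = 1 + x`; multiplying by `1 + x` clears the inverse and leaves a quadratic
    -- in `x`.
    have h1 := key (Real.sqrt (1 + x) - 1) (by linarith [Real.sqrt_pos.2 hx1])
    rw [add_sub_cancel, Real.sq_sqrt hx1.le] at h1
    have h2 := mul_le_mul_of_nonneg_left h1 hx1.le
    have h3 : (1 + x) * ((EW + (1 + x - 1) * u) * (EH + ((1 + x)⁻¹ - 1) * w))
        = (EW + x * u) * ((1 + x) * EH - x * w) := by
      field_simp; ring
    rw [h3] at h2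
    nlinarith [h2]
  linarith

/-- At a minimizer with active constraints the two Gram matrices of the inner dimension are
proportional. -/
theorem IsMinimizer.balanced (hd : m ≤ d) (hEW : 0 < EW) (hEH : 0 < EH)
    (hactive : ActiveConstraints d Y EW EH) (hmin : IsMinimizer Y EW EH W H) :
    EH • (Wᵀ * W) = EW • (H * Hᵀ) := by
  have hunit := hmin.balanced_of_unit hd hEW hEH hactive
  have hdiag : ∀ k, EH * ∑ i, W i k ^ 2 = EW * ∑ j, H k j ^ 2 := fun k => by
    have := hunit (Pi.single k 1) (by simp [Pi.single_apply])
    simpa [Pi.single_apply] using this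
  ext k l
  simp only [Matrix.smul_apply, Matrix.mul_apply, Matrix.transpose_apply, smul_eq_mul]
  rcases eq_or_ne k l with rfl | hkl
  · simpa only [← sq] using hdiag k
  -- Polarization with a rational unit vector, which avoids square roots.
  · set v : Fin d → ℝ := Pi.single k (3 / 5) + Pi.single l (4 / 5) with hv
    have hlin : ∀ f : Fin d → ℝ, ∑ p, f p * v p = 3 / 5 * f k + 4 / 5 * f l := fun f => by
      simp [hv, Pi.single_apply, mul_add, Finset.sum_add_distrib, mul_comm]
    have hvk : v k = 3 / 5 := by simp [hv, hkl]
    have hvl : v l = 4 / 5 := by simp [hv, hkl.symm]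
    have h1 := hunit v (by simp only [sq]; rw [hlin, hvk, hvl]; norm_num)
    have h2 : ∀ j, ∑ p, v p * H p j = 3 / 5 * H k j + 4 / 5 * H l j := fun j => by
      simp only [mul_comm (v _)]; exact hlin fun p => H p j
    have h3 : ∀ x y : ℝ, (3 / 5 * x + 4 / 5 * y) ^ 2
        = 9 / 25 * x ^ 2 + 16 / 25 * y ^ 2 + 24 / 25 * (x * y) := fun x y => by ring
    simp only [hlin, h2, h3, Finset.sum_add_distrib, ← Finset.mul_sum] at h1
    linarith [hdiag k, hdiag l]

/-- Balancedness turns `W * (H * Hᵀ) * Wᵀ` into a multiple of `(W * Wᵀ) ^ 2`, and positive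
semidefinite roots are unique. -/
theorem IsMinimizer.gram_left (hd : m ≤ d) (hEW : 0 < EW) (hEH : 0 < EH)
    (hactive : ActiveConstraints d Y EW EH) (hmin : IsMinimizer Y EW EH W H) :
    W * Wᵀ = Real.sqrt (EW / EH) • CFC.sqrt ((W * H) * (W * H)ᵀ) := by
  have hbal : H * Hᵀ = (EH / EW) • (Wᵀ * W) := by
    rw [div_eq_inv_mul, mul_smul, hmin.balanced hd hEW hEH hactive, smul_smul,
      inv_mul_cancel₀ hEW.ne', one_smul]
  have hpos : 0 < EH / EW := div_pos hEH hEW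
  have hroot : CFC.sqrt ((W * H) * (W * H)ᵀ) = Real.sqrt (EH / EW) • (W * Wᵀ) := by
    refine CFC.sqrt_unique ?_ ?_
    · have : (W * H) * (W * H)ᵀ = W * (H * Hᵀ) * Wᵀ := by
        simp only [Matrix.transpose_mul, Matrix.mul_assoc]
      rw [this, hbal, smul_mul_smul_comm, Real.mul_self_sqrt hpos.le]
      simp only [Matrix.mul_smul, Matrix.smul_mul, Matrix.mul_assoc]
    · have := Matrix.posSemidef_self_mul_conjTranspose W
      rw [Matrix.conjTranspose_eq_transpose_of_trivial] at this
      exact (this.smul (Real.sqrt_nonneg _)).nonneg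
  rw [hroot, smul_smul, ← Real.sqrt_mul (div_pos hEW hEH).le]
  have : EW / EH * (EH / EW) = 1 := by field_simp
  rw [this, Real.sqrt_one, one_smul]

theorem IsMinimizer.gram_right (hd : m ≤ d) (hEW : 0 < EW) (hEH : 0 < EH)
    (hactive : ActiveConstraints d Y EW EH) (hmin : IsMinimizer Y EW EH W H) :
    Hᵀ * H = Real.sqrt (EH / EW) • CFC.sqrt ((W * H)ᵀ * (W * H)) := by
  have hbal : Wᵀ * W = (EW / EH) • (H * Hᵀ) := by
    rw [div_eq_inv_mul, mul_smul, ← hmin.balanced hd hEW hEH hactive, smul_smul,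
      inv_mul_cancel₀ hEH.ne', one_smul]
  have hpos : 0 < EW / EH := div_pos hEW hEH
  have hroot : CFC.sqrt ((W * H)ᵀ * (W * H)) = Real.sqrt (EW / EH) • (Hᵀ * H) := by
    refine CFC.sqrt_unique ?_ ?_
    · have : (W * H)ᵀ * (W * H) = Hᵀ * (Wᵀ * W) * H := by
        simp only [Matrix.transpose_mul, Matrix.mul_assoc]
      rw [this, hbal, smul_mul_smul_comm, Real.mul_self_sqrt hpos.le]
      simp only [Matrix.mul_smul, Matrix.smul_mul, Matrix.mul_assoc]
    · have := Matrix.posSemidef_conjTranspose_mul_self H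
      rw [Matrix.conjTranspose_eq_transpose_of_trivial] at this
      exact (this.smul (Real.sqrt_nonneg _)).nonneg
  rw [hroot, smul_smul, ← Real.sqrt_mul (div_pos hEH hEW).le]
  have : EH / EW * (EW / EH) = 1 := by field_simp
  rw [this, Real.sqrt_one, one_smul]

end Minimizer

/-! ### Cyclic symmetry -/

theorem shiftMatrix_apply {m : ℕ} (a : Fin m → ℝ) (i j : Fin m) :
    shiftMatrix a i j = a (i - j) := by
  rw [shiftMatrix_eq_circulant, Matrix.circulant_apply]

section Cyclic

variable {m d : ℕ} [NeZero m] {y : Fin m → ℝ} {EW EH : ℝ}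
  {W : Matrix (Fin m) (Fin d) ℝ} {H : Matrix (Fin d) (Fin m) ℝ}

theorem eq_shiftMatrix_of_submatrix_eq {A : Matrix (Fin m) (Fin m) ℝ}
    (h : ∀ t, A.submatrix (Equiv.subRight t) (Equiv.subRight t) = A) :
    A = shiftMatrix fun i => A i 0 := by
  ext i j
  rw [shiftMatrix_apply]
  conv_lhs => rw [← h j]
  simp

theorem reducedObjective_shift (y z : Fin m → ℝ) (j : Fin m) :
    reducedObjective ((shiftMatrix y).col j) ((shiftMatrix z).col j) = reducedObjective y z := by
  rw [← reducedObjective_comp_equiv (Equiv.subRight j) y z]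
  congr 1 <;> ext i <;> simp [shiftMatrix_apply]

theorem logitLoss_shiftMatrix (y z : Fin m → ℝ) :
    logitLoss (shiftMatrix y) (shiftMatrix z) = m * reducedObjective y z := by
  simp [logitLoss, reducedObjective_shift]

theorem sum_col_shiftMatrix (hy : ∑ i, y i = 1) (j : Fin m) :
    ∑ i, (shiftMatrix y).col j i = 1 := by
  simp only [Matrix.col_apply, shiftMatrix_apply]
  rw [← hy]
  exact Equiv.sum_comp (Equiv.subRight j) y

/-- The target is invariant under a simultaneous shift of rows and columns, and the norms do not see
permutations. -/
theorem IsMinimizer.shift (hmin : IsMinimizer (shiftMatrix y) EW EH W H) (t : Fin m) :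
    IsMinimizer (shiftMatrix y) EW EH (W.submatrix (Equiv.subRight t) id)
      (H.submatrix id (Equiv.subRight t)) := by
  obtain ⟨⟨hW, hH⟩, hle⟩ := isMinimizer_iff.1 hmin
  refine isMinimizer_iff.2 ⟨⟨le_of_eq_of_le ?_ hW, le_of_eq_of_le ?_ hH⟩, fun W' H' hW' hH' =>
    le_of_eq_of_le ?_ (hle W' H' hW' hH')⟩
  · exact Equiv.sum_comp (Equiv.subRight t) fun i => ∑ k, W i k ^ 2
  · exact Finset.sum_congr rfl fun k _ => Equiv.sum_comp (Equiv.subRight t) fun j => H k j ^ 2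
  · rw [logitLoss, logitLoss, ← Equiv.sum_comp (Equiv.subRight t) fun j =>
      reducedObjective ((shiftMatrix y).col j) ((W * H).col j)]
    refine Finset.sum_congr rfl fun j _ => ?_
    refine Eq.trans ?_ (reducedObjective_comp_equiv (Equiv.subRight t) _ _)
    congr 1
    ext i
    simp [shiftMatrix_apply]

variable (hd : m ≤ d) (hEW : 0 < EW) (hEH : 0 < EH) (hy : ∑ i, y i = 1)
  (hactive : ActiveConstraints d (shiftMatrix y) EW EH)
  (hmin : IsMinimizer (shiftMatrix y) EW EH W H)

include hd hEW hEH hy hactive hmin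

theorem IsMinimizer.submatrix_mul (t : Fin m) :
    (W * H).submatrix (Equiv.subRight t) (Equiv.subRight t) = W * H :=
  ((hmin.shift t).mul_eq_mul hd hEW hEH (sum_col_shiftMatrix hy) hactive hmin)

/-- Uniqueness concerns `W * H` and not `W`, but by `gram_left` the Gram matrix depends on `W * H`
alone. -/
theorem IsMinimizer.submatrix_gram_left (t : Fin m) :
    (W * Wᵀ).submatrix (Equiv.subRight t) (Equiv.subRight t) = W * Wᵀ := by
  have h := (hmin.shift t).gram_left hd hEW hEH hactive
  rw [(hmin.shift t).mul_eq_mul hd hEW hEH (sum_col_shiftMatrix hy) hactive hmin,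
    ← hmin.gram_left hd hEW hEH hactive] at h
  exact h

theorem IsMinimizer.mul_eq_shiftMatrix : W * H = shiftMatrix fun i => (W * H) i 0 :=
  eq_shiftMatrix_of_submatrix_eq (hmin.submatrix_mul hd hEW hEH hy hactive)

theorem IsMinimizer.transpose_mul_self :
    (W * H)ᵀ * (W * H) = (W * H) * (W * H)ᵀ := by
  rw [hmin.mul_eq_shiftMatrix hd hEW hEH hy hactive, shiftMatrix_eq_circulant,
    Matrix.transpose_circulant, Matrix.circulant_mul_comm]

end Cyclic

/-! ### The discrete Fourier transform -/

/-- The characters of the cyclic group of order `m`. -/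
noncomputable def character (m : ℕ) (k l : Fin m) : ℂ :=
  Complex.exp (2 * Real.pi * Complex.I * (((k : ℕ) * (l : ℕ) : ℕ) : ℤ) / (m : ℂ))

section Fourier

variable {m : ℕ} [NeZero m]

theorem character_eq_stdAddChar (k l : Fin m) :
    character m k l = ZMod.stdAddChar (N := m) (((k : ℕ) : ZMod m) * ((l : ℕ) : ZMod m)) := by
  rw [character, ← ZMod.stdAddChar_coe]
  push_cast
  rfl

omit [NeZero m] in
theorem conj_character (k l : Fin m) :
    (starRingEnd ℂ) (character m k l) =
      Complex.exp (-2 * Real.pi * Complex.I * ((k : ℕ) : ℂ) * ((l : ℕ) : ℂ) / (m : ℂ)) := by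
  rw [character, ← Complex.exp_conj]
  congr 1
  simp only [map_div₀, map_mul, Complex.conj_I, Complex.conj_ofReal, map_natCast, map_ofNat]
  push_cast
  simp only [map_mul, map_natCast]
  ring

theorem norm_character (k l : Fin m) : ‖character m k l‖ = 1 := by
  rw [character_eq_stdAddChar, AddChar.norm_apply]

omit [NeZero m] in
theorem natCast_sub_fin (i j : Fin m) :
    (((i - j : Fin m) : ℕ) : ZMod m) = ((i : ℕ) : ZMod m) - ((j : ℕ) : ZMod m) := by
  rw [Fin.sub_def]
  simp only [ZMod.natCast_mod, Nat.cast_add, Nat.cast_sub j.is_lt.le, ZMod.natCast_self]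
  ring

theorem character_sub (k i j : Fin m) :
    character m k (i - j) = character m k i * (starRingEnd ℂ) (character m k j) := by
  simp only [character_eq_stdAddChar, natCast_sub_fin, mul_sub]
  rw [sub_eq_add_neg, AddChar.map_add_eq_mul, AddChar.map_neg_eq_conj]

theorem sum_character (l : Fin m) : ∑ k, character m k l = if l = 0 then (m : ℂ) else 0 := by
  have hbij : Function.Bijective fun k : Fin m => ((k : ℕ) : ZMod m) := by
    rw [Fintype.bijective_iff_injective_and_card]
    refine ⟨fun a b hab => ?_, by simp [ZMod.card]⟩
    have := (ZMod.natCast_eq_natCast_iff' _ _ _).1 hab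
    rwa [Nat.mod_eq_of_lt a.is_lt, Nat.mod_eq_of_lt b.is_lt, ← Fin.ext_iff] at this
  have h := AddChar.sum_mulShift (((l : ℕ) : ZMod m)) (ZMod.isPrimitive_stdAddChar m)
  rw [← hbij.sum_comp fun x : ZMod m => ZMod.stdAddChar (x * ((l : ℕ) : ZMod m))] at h
  simp only [character_eq_stdAddChar]
  rw [h]
  have hl : ((l : ℕ) : ZMod m) = 0 ↔ l = 0 := by
    constructor
    · intro h0
      exact hbij.1 (by simpa using h0)
    · rintro rfl; simp
  simp only [hl, ZMod.card]
  split_ifs <;> simp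

/-- Parseval's identity. -/
theorem sum_norm_sq_fourier (x : Fin m → ℝ) :
    ∑ k, ‖∑ l, (x l : ℂ) * character m k l‖ ^ 2 = m * ∑ l, x l ^ 2 := by
  have h : ∀ k, ((‖∑ l, (x l : ℂ) * character m k l‖ ^ 2 : ℝ) : ℂ)
      = ∑ i, ∑ j, (x i : ℂ) * x j * character m k (i - j) := fun k => by
    push_cast
    rw [← Complex.mul_conj', map_sum, Finset.sum_mul_sum]
    refine Finset.sum_congr rfl fun i _ => Finset.sum_congr rfl fun j _ => ?_
    rw [map_mul, Complex.conj_ofReal, character_sub]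
    ring
  have h2 : ((∑ k, ‖∑ l, (x l : ℂ) * character m k l‖ ^ 2 : ℝ) : ℂ)
      = ((m * ∑ l, x l ^ 2 : ℝ) : ℂ) := by
    rw [Complex.ofReal_sum, Finset.sum_congr rfl fun k _ => h k, Finset.sum_comm]
    simp only [Finset.sum_comm (f := fun k j => (x _ : ℂ) * x j * character m k (_ - j)),
      ← Finset.mul_sum, sum_character, sub_eq_zero]
    simp [Finset.mul_sum, mul_comm, sq]
  exact_mod_cast h2

/-- The Fourier coefficients in the constraint of the reduced program. -/
noncomputable def fourierCoeff (z : Fin m → ℝ) (k : Fin m) : ℂ :=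
  ∑ l, (z l : ℂ) * (starRingEnd ℂ) (character m k l)

omit [NeZero m] in
theorem mem_reducedFeasibleSet_iff {EW EH : ℝ} {z : Fin m → ℝ} :
    z ∈ reducedFeasibleSet m EW EH ↔ ∑ k, ‖fourierCoeff z k‖ ≤ Real.sqrt (EW * EH) := by
  simp only [reducedFeasibleSet, fourierCoeff, conj_character, Set.mem_ofPred_eq]

/-- Fourier inversion, from orthogonality of the characters. -/
theorem sum_fourierCoeff_mul_character (z : Fin m → ℝ) (i : Fin m) :
    ∑ k, fourierCoeff z k * character m k i = m * z i := by
  have h : ∀ k, fourierCoeff z k * character m k i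
      = ∑ l, (z l : ℂ) * character m k (i - l) := fun k => by
    rw [fourierCoeff, Finset.sum_mul]
    refine Finset.sum_congr rfl fun l _ => ?_
    rw [character_sub]; ring
  simp only [h]
  rw [Finset.sum_comm]
  simp only [← Finset.mul_sum, sum_character, sub_eq_zero]
  simp [mul_comm]

/-- The absolute values of the eigenvalues of a circulant matrix sum to at most the product of the
Frobenius norms of any two factors. -/
theorem sum_norm_fourierCoeff_le {ι : Type*} [Fintype ι] {z : Fin m → ℝ}
    {W : Matrix (Fin m) ι ℝ} {H : Matrix ι (Fin m) ℝ} (hz : W * H = shiftMatrix z) :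
    ∑ k, ‖fourierCoeff z k‖ ≤ Real.sqrt (sqSum W * sqSum H) := by
  have hm : (0 : ℝ) < m := Nat.cast_pos.2 (Nat.pos_of_neZero m)
  set u : Fin m → ι → ℂ := fun k c => ∑ i, (W i c : ℂ) * character m k i with hu
  set h : Fin m → ι → ℂ := fun k c => ∑ j, (H c j : ℂ) * character m k j with hh
  -- The `k`-th character is an eigenvector of `shiftMatrix z` with eigenvalue `fourierCoeff z k`
  -- and squared norm `m`; evaluate the sesquilinear form of `W * H` on it.
  have key : ∀ k, (m : ℂ) * fourierCoeff z k = ∑ c, (starRingEnd ℂ) (u k c) * h k c :=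
    fun k => by
      have h1 : ∀ j, fourierCoeff z k = ∑ i, (shiftMatrix z i j : ℂ) *
          ((starRingEnd ℂ) (character m k i) * character m k j) := fun j => by
        rw [fourierCoeff, ← Equiv.sum_comp (Equiv.subRight j)]
        refine Finset.sum_congr rfl fun i _ => ?_
        simp [shiftMatrix_apply, character_sub]
      have h2 : (m : ℂ) * fourierCoeff z k = ∑ j : Fin m, fourierCoeff z k := by simp
      rw [h2, Finset.sum_congr rfl fun j _ => h1 j]
      simp only [hu, hh, map_sum, map_mul, Complex.conj_ofReal, Finset.sum_mul_sum]
      simp only [← hz, Matrix.mul_apply, Complex.ofReal_sum, Complex.ofReal_mul, Finset.sum_mul]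
      rw [Finset.sum_comm]
      conv_lhs => enter [2, i]; rw [Finset.sum_comm]
      rw [Finset.sum_comm]
      refine Finset.sum_congr rfl fun c _ => Finset.sum_congr rfl fun i _ =>
        Finset.sum_congr rfl fun j _ => ?_
      ring
  have hle : ∀ k, m * ‖fourierCoeff z k‖ ≤ ∑ c, ‖u k c‖ * ‖h k c‖ := fun k => by
    have : m * ‖fourierCoeff z k‖ = ‖(m : ℂ) * fourierCoeff z k‖ := by simp
    rw [this, key k]
    refine (norm_sum_le _ _).trans (le_of_eq ?_)
    simp
  have hsu : ∑ p : Fin m × ι, ‖u p.1 p.2‖ ^ 2 = m * sqSum W := by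
    rw [Fintype.sum_prod_type, Finset.sum_comm, sqSum_comm, Finset.mul_sum]
    exact Finset.sum_congr rfl fun c _ => sum_norm_sq_fourier fun i => W i c
  have hsh : ∑ p : Fin m × ι, ‖h p.1 p.2‖ ^ 2 = m * sqSum H := by
    rw [Fintype.sum_prod_type, Finset.sum_comm, sqSum, Finset.mul_sum]
    exact Finset.sum_congr rfl fun c _ => sum_norm_sq_fourier fun j => H c j
  -- Cauchy–Schwarz over all pairs `(k, c)` at once, so that Parseval yields the full Frobenius
  -- norms.
  have hcs := Real.sum_mul_le_sqrt_mul_sqrt Finset.univ (fun p : Fin m × ι => ‖u p.1 p.2‖)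
    fun p => ‖h p.1 p.2‖
  rw [hsu, hsh, Fintype.sum_prod_type,
    ← Real.sqrt_mul (mul_nonneg hm.le (sqSum_nonneg W))] at hcs
  have hroot : Real.sqrt (m * sqSum W * (m * sqSum H)) = m * Real.sqrt (sqSum W * sqSum H) := by
    rw [show (m * sqSum W * (m * sqSum H) : ℝ) = (m : ℝ) ^ 2 * (sqSum W * sqSum H) by ring,
      Real.sqrt_mul (sq_nonneg _), Real.sqrt_sq hm.le]
  rw [hroot] at hcs
  refine le_of_mul_le_mul_left ?_ hm
  rw [Finset.mul_sum]
  exact (Finset.sum_le_sum fun k _ => hle k).trans hcs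

/-- The factors are the real forms of `F |Λ|^(1/2)` and `Λ |Λ|^(-1/2) F⁻¹`, where `F Λ F⁻¹` is
the Fourier diagonalization of the circulant matrix. -/
theorem exists_factorization_shiftMatrix (z : Fin m → ℝ) :
    ∃ (W : Matrix (Fin m) (Fin m ⊕ Fin m) ℝ) (H : Matrix (Fin m ⊕ Fin m) (Fin m) ℝ),
      W * H = shiftMatrix z ∧ sqSum W * sqSum H = (∑ k, ‖fourierCoeff z k‖) ^ 2 := by
  have hm : (m : ℝ) ≠ 0 := Nat.cast_ne_zero.2 (NeZero.ne m)
  have hmC : (m : ℂ) ≠ 0 := Nat.cast_ne_zero.2 (NeZero.ne m)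
  set α : Fin m → ℝ := fun k => Real.sqrt ‖fourierCoeff z k‖ with hα
  set A : Matrix (Fin m) (Fin m) ℂ := Matrix.of fun i k => (α k : ℂ) * character m k i with hA
  set B : Matrix (Fin m) (Fin m) ℂ := Matrix.of fun k j =>
    fourierCoeff z k / α k * (starRingEnd ℂ) (character m k j) / m with hB
  have hα2 : ∀ k, α k ^ 2 = ‖fourierCoeff z k‖ := fun k => Real.sq_sqrt (norm_nonneg _)
  -- If `α k = 0` the coefficient vanishes too, so division by zero does no harm.
  have hβ : ∀ k, (α k : ℂ) * (fourierCoeff z k / α k) = fourierCoeff z k := fun k => by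
    rcases eq_or_ne (α k) 0 with h0 | h0
    · have : fourierCoeff z k = 0 := by rw [← norm_eq_zero, ← hα2, h0]; simp
      simp [this]
    · exact mul_div_cancel₀ _ (Complex.ofReal_ne_zero.2 h0)
  have hAB : ∀ i j, ∑ k, A i k * B k j = (z (i - j) : ℂ) := fun i j => by
    have h1 : ∀ k, A i k * B k j = fourierCoeff z k * character m k (i - j) / m := fun k => by
      simp only [hA, hB, Matrix.of_apply]
      rw [character_sub]
      conv_rhs => rw [← hβ k]
      ring
    simp only [h1, ← Finset.sum_div]
    rw [sum_fourierCoeff_mul_character, mul_div_cancel_left₀ _ hmC]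
  have hnA : ∀ i k, ‖A i k‖ ^ 2 = ‖fourierCoeff z k‖ := fun i k => by
    simp only [hA, Matrix.of_apply, norm_mul, norm_character, mul_one, Complex.norm_real,
      Real.norm_eq_abs, sq_abs, hα2]
  have hnB : ∀ k j, ‖B k j‖ ^ 2 = ‖fourierCoeff z k‖ / (m : ℝ) ^ 2 := fun k j => by
    simp only [hB, Matrix.of_apply, norm_div, norm_mul, RCLike.norm_conj, norm_character,
      mul_one, Complex.norm_real, Real.norm_eq_abs, Complex.norm_natCast, div_pow, sq_abs, hα2]
    congr 1
    rcases eq_or_ne ‖fourierCoeff z k‖ 0 with h0 | h0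
    · simp [h0]
    · field_simp
  -- The product `A * B` is real, so it equals `Re A * Re B - Im A * Im B`; hence the sign.
  refine ⟨Matrix.fromCols (A.map Complex.re) (-A.map Complex.im),
    Matrix.fromRows (B.map Complex.re) (B.map Complex.im), ?_, ?_⟩
  · ext i j
    have h1 := congrArg Complex.re (hAB i j)
    rw [Complex.re_sum, Complex.ofReal_re] at h1
    rw [shiftMatrix_apply, ← h1, Matrix.fromCols_mul_fromRows]
    simp [Matrix.mul_apply, Complex.mul_re, Finset.sum_add_distrib, sub_eq_add_neg]
  · have hWA : sqSum (Matrix.fromCols (A.map Complex.re) (-A.map Complex.im))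
        = ∑ i, ∑ k, ‖A i k‖ ^ 2 := by
      simp [sqSum, Complex.sq_norm, Complex.normSq_apply, Finset.sum_add_distrib, ← sq]
    have hHB : sqSum (Matrix.fromRows (B.map Complex.re) (B.map Complex.im))
        = ∑ k, ∑ j, ‖B k j‖ ^ 2 := by
      simp [sqSum, Complex.sq_norm, Complex.normSq_apply, Finset.sum_add_distrib, ← sq]
    rw [hWA, hHB]
    simp only [hnA, hnB, Finset.sum_const, Finset.card_univ, Fintype.card_fin, nsmul_eq_mul,
      ← Finset.mul_sum, ← Finset.sum_div]
    field_simp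

end Fourier

end LayerPeeled


theorem mainTheorem1 {m d : ℕ} (hd : m ≤ d) (EW EH : ℝ) (hEW : 0 < EW) (hEH : 0 < EH)
    (y : Fin m → ℝ) (hy : y ∈ stdSimplex ℝ (Fin m)) (hy_nonuniform : y ≠ fun _ => 1 / (m : ℝ))
    (hactive : LayerPeeled.ActiveConstraints d (LayerPeeled.shiftMatrix y) EW EH) :
    -- the reduced program is convex
    (ConvexOn ℝ Set.univ (LayerPeeled.reducedObjective y) ∧
      Convex ℝ (LayerPeeled.reducedFeasibleSet m EW EH)) ∧
    ∀ (W : Matrix (Fin m) (Fin d) ℝ) (H : Matrix (Fin d) (Fin m) ℝ),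
      LayerPeeled.IsMinimizer (LayerPeeled.shiftMatrix y) EW EH W H →
      -- the logit matrix is circulant and its generating vector solves the reduced program
      (∃ z : Fin m → ℝ, W * H = LayerPeeled.shiftMatrix z ∧
        z ∈ LayerPeeled.reducedFeasibleSet m EW EH ∧
        IsMinOn (LayerPeeled.reducedObjective y)
          (LayerPeeled.reducedFeasibleSet m EW EH) z) ∧
      -- the Gram matrices
      W * Wᵀ = Real.sqrt (EW / EH) • CFC.sqrt ((W * H) * (W * H)ᵀ) ∧
      Hᵀ * H = Real.sqrt (EH / EW) • CFC.sqrt ((W * H) * (W * H)ᵀ) ∧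
      LayerPeeled.IsCirculant (CFC.sqrt ((W * H) * (W * H)ᵀ)) ∧
      LayerPeeled.IsCirculant (W * Wᵀ) ∧
      LayerPeeled.IsCirculant (Hᵀ * H) := by
  have hm0 : m ≠ 0 := by
    rintro rfl
    simpa using hy.2
  have : NeZero m := ⟨hm0⟩
  have hm : (0 : ℝ) < m := Nat.cast_pos.2 (Nat.pos_of_neZero m)
  refine ⟨⟨LayerPeeled.convexOn_reducedObjective hy.2,
    LayerPeeled.convex_reducedFeasibleSet m EW EH⟩, fun W H hmin => ?_⟩
  have hz := hmin.mul_eq_shiftMatrix hd hEW hEH hy.2 hactive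
  have hleft := hmin.gram_left hd hEW hEH hactive
  have hright := hmin.gram_right hd hEW hEH hactive
  -- Normality of the circulant matrix `W * H` puts the same root into both Gram identities.
  rw [hmin.transpose_mul_self hd hEW hEH hy.2 hactive] at hright
  obtain ⟨hW, hH⟩ := hmin.sqSum_eq hactive
  have hcirc : ∀ {A : Matrix (Fin m) (Fin m) ℝ} (c : ℝ), LayerPeeled.IsCirculant A →
      LayerPeeled.IsCirculant (c • A) := by
    rintro A c ⟨a, rfl⟩
    exact ⟨c • a, by simp [LayerPeeled.shiftMatrix_eq_circulant, Matrix.circulant_smul]⟩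
  have hWW : LayerPeeled.IsCirculant (W * Wᵀ) :=
    ⟨_, LayerPeeled.eq_shiftMatrix_of_submatrix_eq
      (hmin.submatrix_gram_left hd hEW hEH hy.2 hactive)⟩
  -- The root is a multiple of `W * Wᵀ`, already known to be circulant.
  have hroot : LayerPeeled.IsCirculant (CFC.sqrt ((W * H) * (W * H)ᵀ)) := by
    have h := hcirc (Real.sqrt (EW / EH))⁻¹ hWW
    rwa [hleft, smul_smul, inv_mul_cancel₀ (Real.sqrt_pos.2 (div_pos hEW hEH)).ne',
      one_smul] at h
  refine ⟨⟨_, hz, ?_, ?_⟩, hleft, hright, hroot, hWW, ?_⟩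
  · have h := LayerPeeled.sum_norm_fourierCoeff_le hz
    rw [hW, hH] at h
    exact LayerPeeled.mem_reducedFeasibleSet_iff.2 h
  · refine isMinOn_iff.2 fun z' hz' => ?_
    -- A feasible `z'` lifts to a circulant competitor, whose loss is `m` times the reduced
    -- objective.
    obtain ⟨W', H', hmul, hsq⟩ := LayerPeeled.exists_factorization_shiftMatrix z'
    have hle := hmin.logitLoss_le hd hEW hEH W' H' (by
      rw [hsq]
      refine (pow_le_pow_left₀ (Finset.sum_nonneg fun _ _ => norm_nonneg _)
        (LayerPeeled.mem_reducedFeasibleSet_iff.1 hz') 2).trans (le_of_eq ?_)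
      exact Real.sq_sqrt (mul_pos hEW hEH).le)
    rw [hmul, hz, LayerPeeled.logitLoss_shiftMatrix, LayerPeeled.logitLoss_shiftMatrix] at hle
    exact le_of_mul_le_mul_left hle hm
  · rw [hright]
    exact hcirc _ hroot
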